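/- Let $d\ge 1$ and equip $\mathbb Z^d$ with the Euclidean distance $d(\cdot,\cdot)$. For $p\in\mathbb Z^d$ and $r\in\mathbb N_0$ put $B_p(r)=\{i\in\mathbb Z^d: d(p,i)\le r-1\}$ (so $B_p(0)=\emptyset$), and let $K_d$ be the smallest constant with $|B_j(r+1)\setminus B_j(r)|\le K_d\,r^{d-1}$ for all $j\in\mathbb Z^d$ and all integers $r\ge 1$. Let $n_j\ge 1$ $(j\in\mathbb Z^d)$ be integers; for finite $\Lambda\subset\mathbb Z^d$ let $\mathbb A(\Lambda)=\bigotimes_{j\in\Lambda}\mathrm{Mat}_{n_j}(\mathbb C)$, and let $\mathbb A$ be the quasi-local algebra, i.e. the $C^*$-completion of $\mathbb A_{\rm loc}=\varinjlim_\Lambda \mathbb A(\Lambda)$ along the inclusions $A\mapsto A\otimes\mathbf 1$. Let $\alpha$ be a $*$-automorphism of $\mathbb A$. Let $F:[0,\infty)\to[0,\infty)$ be monotonically decreasing (non-increasing) and reproducing, i.e. $$\sup_{x}\sum_{y}F(d(x,y))<\infty,\qquad \sup_{x,y}\sum_{z}\frac{F(d(x,z))\,F(d(z,y))}{F(d(x,y))}<\infty$$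 (suprema and sums over $\mathbb Z^d$; conventions $0/0=0$ and $a/0=\infty$ for $a>0$). Suppose that for all finite $\Lambda_1,\Lambda_2\subset\mathbb Z^d$ and all $A\in\mathbb A(\Lambda_1)$, $B\in\mathbb A(\Lambda_2)$, $$\|[\alpha(A),B]\|\le\|A\|\,\|B\|\sum_{i\in\Lambda_1}\sum_{j\in\Lambda_2}F(d(i,j)).$$ For $t\in\mathbb N_0$ set $$g_F(t)=\sum_{k,l=1}^{\infty}(t+k+l-1)^{d-1}F(t+k+l-2)\in[0,\infty],\qquad f_F=K_d^2\,g_F .$$ (1) If $g_F(t)<\infty$ for all $t\in\mathbb N_0$, then for all $p\in\mathbb Z^d$ and all integers $s\ge1$, $r\ge0$, the algebra $\alpha(\mathbb A(B_p(s)))$ is $s^{d-1}f_F(r)$-contained in $\mathbb A(B_p(s+r))$: for every $A\in\alpha(\mathbb A(B_p(s)))$ there is $A'\in\mathbb A(B_p(s+r))$ with $\|A-A'\|\le s^{d-1}f_F(r)\,\|A\|$. (2) If $F$ is rapidly decreasing, i.e. $\sup_{r\in\mathbb N_0}(1+r)^kF(r)<\infty$ for every $k\in\mathbb N_0$, then: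 (a) $\alpha$ is approximately locality preserving with $f_F$-tails: $f_F$ is finite, non-negative, non-increasing and rapidly decreasing on $\mathbb N_0$, and the containment in (1) holds for all $p\in\mathbb Z^d$, $s\ge 1$, $r\ge 0$; (b) $\alpha$ is almost locality preserving: there is a non-negative, non-increasing, rapidly decreasing $f:\mathbb N_0\to\mathbb R$ with $H_\alpha(s,r)\le s^{d-1}f(r)$ for all $s\ge1$, $r\ge0$, where $H_\alpha(s,0)=1$ and, for $r\ge1$, $H_\alpha(s,r)=\sup_{p\in\mathbb Z^d}\ \sup_{A\in\mathbb A(B_p(s)),\,\|A\|=1}\ \inf_{B\in\mathbb A(B_p(s+r))}\|\alpha(A)-B\|$; (c) $\alpha$ is Fréchet continuous: with $f_r(A)=\inf_{B\in\mathbb A(B_0(r))}\|A-B\|$, with $\mathbb A_\infty$ the set of $A\in\mathbb A$ for which $r\mapsto f_r(A)$ is rapidly decreasing, and with the norms $|||A|||'_k=\|A\|+\sup_{r\in\mathbb N_0}(1+r)^kf_r(A)$ on $\mathbb A_\infty$, one has $\alpha(\mathbb A_\infty)\subseteq\mathbb A_\infty$, and for every $k$ there are $m\in\mathbb N_0$ and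 $C>0$ with $|||\alpha(A)|||'_k\le C\,|||A|||'_m$ for all $A\in\mathbb A_\infty$. -/

import Mathlib

open scoped NNReal ENNReal Kronecker Matrix.Norms.L2Operator

noncomputable section

namespace SpinLattice

/-! ## The quasi-local algebra of a quantum spin system on `ℤ^d` -/

/-- The lattice `ℤ^d`.  (Only its underlying set is used; the distance is the Euclidean `latticeDist`.) -/
abbrev Lattice (d : ℕ) : Type := Fin d → ℤ

variable {d : ℕ}

/-- Index set of the product basis of `⨂_{j ∈ Λ} ℂ^{n j}`. -/
abbrev Config (n : Lattice d → ℕ) (Λ : Finset (Lattice d)) : Type := (j : Λ) → Fin (n j)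

/-- The algebra `𝔸(Λ) = ⨂_{j ∈ Λ} Mat_{n j}(ℂ)` of a finite region, realised as the matrices
indexed by the product basis, with the `C⋆`-norm (the operator norm of `⨂_{j ∈ Λ} ℂ^{n j}`). -/
abbrev RegionAlg (n : Lattice d → ℕ) (Λ : Finset (Lattice d)) : Type :=
  Matrix (Config n Λ) (Config n Λ) ℂ

/-- A configuration on `Δ ⊇ Λ` is a configuration on `Λ` together with one on `Δ \ Λ`. -/
def splitConfig (n : Lattice d → ℕ) {Λ Δ : Finset (Lattice d)} (h : Λ ≤ Δ) :
    Config n Δ ≃ Config n Λ × ((j : {j : Δ // j.1 ∉ Λ}) → Fin (n j.1)) where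
  toFun σ := (fun j => σ ⟨j.1, h j.2⟩, fun j => σ j.1)
  invFun c j := if hj : j.1 ∈ Λ then c.1 ⟨j.1, hj⟩ else c.2 ⟨j, hj⟩
  left_inv σ := by
    funext j
    by_cases hj : j.1 ∈ Λ <;> simp [hj]
  right_inv c := by
    ext j
    · simp
    · have := j.2
      simp [this]

/-- The inclusion `𝔸(Λ) ↪ 𝔸(Δ)`, `A ↦ A ⊗ 𝟏`, for `Λ ⊆ Δ`. -/
def embed (n : Lattice d → ℕ) {Λ Δ : Finset (Lattice d)} (h : Λ ≤ Δ) :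
    RegionAlg n Λ →⋆ₐ[ℂ] RegionAlg n Δ where
  toFun A := (A ⊗ₖ (1 : Matrix ((j : {j : Δ // j.1 ∉ Λ}) → Fin (n j.1)) _ ℂ)).submatrix
    (splitConfig n h) (splitConfig n h)
  map_one' := by simp
  map_mul' A B := by
    rw [Matrix.submatrix_mul_equiv, ← Matrix.mul_kronecker_mul, one_mul]
  map_zero' := by simp
  map_add' A B := by
    rw [Matrix.add_kronecker]; rfl
  commutes' r := by
    rw [Algebra.algebraMap_eq_smul_one, Algebra.algebraMap_eq_smul_one, Matrix.smul_kronecker,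
      Matrix.one_kronecker_one, Matrix.submatrix_smul]
    simp
  map_star' A := by
    simp only [Matrix.star_eq_conjTranspose, Matrix.conjTranspose_submatrix,
      Matrix.conjTranspose_kronecker, Matrix.conjTranspose_one]

theorem embed_apply (n : Lattice d → ℕ) {Λ Δ : Finset (Lattice d)} (h : Λ ≤ Δ)
    (A : RegionAlg n Λ) (σ τ : Config n Δ) :
    embed n h A σ τ = A (fun j => σ ⟨j.1, h j.2⟩) (fun j => τ ⟨j.1, h j.2⟩) *
      if ∀ j : Δ, j.1 ∉ Λ → σ j = τ j then 1 else 0 := by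
  change A _ _ * (1 : Matrix ((j : {j : Δ // j.1 ∉ Λ}) → Fin (n j.1)) _ ℂ) _ _ = _
  rw [Matrix.one_apply]
  congr 2
  simp [splitConfig, funext_iff]

theorem embed_injective (n : Lattice d → ℕ) [∀ j, NeZero (n j)] {Λ Δ : Finset (Lattice d)}
    (h : Λ ≤ Δ) : Function.Injective (embed n h) := by
  intro A B hAB
  ext a b
  have := congrFun (congrFun hAB ((splitConfig n h).symm (a, fun _ => 0)))
    ((splitConfig n h).symm (b, fun _ => 0))
  change (A ⊗ₖ _) _ _ = (B ⊗ₖ _) _ _ at this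
  simpa using this

theorem norm_embed (n : Lattice d → ℕ) [∀ j, NeZero (n j)] {Λ Δ : Finset (Lattice d)}
    (h : Λ ≤ Δ) (A : RegionAlg n Λ) : ‖embed n h A‖ = ‖A‖ :=
  NonUnitalStarAlgHom.norm_map (embed n h) (embed_injective n h) A

instance (n : Lattice d → ℕ) :
    DirectedSystem (RegionAlg n) (fun _ _ h => (embed n h : _ → _)) where
  map_self Λ A := by
    ext σ τ
    rw [embed_apply, if_pos (fun j hj => absurd j.2 hj), mul_one]
  map_map Γ Δ Λ h h' A := by
    ext σ τ
    rw [embed_apply, embed_apply, embed_apply, mul_assoc]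
    congr 1
    rw [mul_ite, mul_one, mul_zero, ← ite_and]
    congr 1
    refine propext ⟨fun H j hj => ?_, fun H => ⟨fun j hj => H j fun h0 => hj (h h0),
      fun j hj => H _ hj⟩⟩
    by_cases hjΔ : j.1 ∈ Δ
    · exact H.2 ⟨j.1, hjΔ⟩ hj
    · exact H.1 j hjΔ

/-- The `⋆`-algebra of local observables: the inductive limit of the algebras `𝔸(Λ)`. -/
def LocalObs (n : Lattice d → ℕ) : Type :=
  DirectLimit (RegionAlg n) (fun _ _ h => embed n h)

namespace LocalObs

variable (n : Lattice d → ℕ)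

instance : Ring (LocalObs n) :=
  inferInstanceAs (Ring (DirectLimit (RegionAlg n) (fun _ _ h => embed n h)))

instance : Algebra ℂ (LocalObs n) :=
  inferInstanceAs (Algebra ℂ (DirectLimit (RegionAlg n) (fun _ _ h => embed n h)))

instance : StarRing (LocalObs n) :=
  inferInstanceAs (StarRing (DirectLimit (RegionAlg n) (fun _ _ h => embed n h)))

instance : StarModule ℂ (LocalObs n) :=
  inferInstanceAs (StarModule ℂ (DirectLimit (RegionAlg n) (fun _ _ h => embed n h)))

/-- The canonical map `𝔸(Λ) → 𝔸_loc`. -/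
def of (Λ : Finset (Lattice d)) : RegionAlg n Λ →⋆ₐ[ℂ] LocalObs n :=
  { DirectLimit.Algebra.of (R := ℂ) (RegionAlg n) (fun _ _ h => embed n h) Λ with
    map_star' := fun _ => (DirectLimit.star_def _ _).symm }

theorem of_embed {Λ Δ : Finset (Lattice d)} (h : Λ ≤ Δ) (A : RegionAlg n Λ) :
    of n Δ (embed n h A) = of n Λ A :=
  DirectLimit.Algebra.of_f (R := ℂ) (f := fun _ _ h => embed n h) h A

theorem exists_of (x : LocalObs n) : ∃ Λ A, x = of n Λ A :=
  DirectLimit.exists_eq_mk _ x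

theorem exists_of₂ (x y : LocalObs n) : ∃ Λ A B, x = of n Λ A ∧ y = of n Λ B :=
  DirectLimit.exists_eq_mk₂ _ x y

variable [∀ j, NeZero (n j)]

/-- The norm of a local observable is its norm in any `𝔸(Λ)` containing it. -/
instance : Norm (LocalObs n) where
  norm := DirectLimit.lift (fun _ _ h => embed n h) (fun _ A => ‖A‖)
    (fun _ _ h A => (norm_embed n h A).symm)

@[simp] theorem norm_of (Λ : Finset (Lattice d)) (A : RegionAlg n Λ) : ‖of n Λ A‖ = ‖A‖ := rfl

theorem of_injective (Λ : Finset (Lattice d)) : Function.Injective (of n Λ) := by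
  intro A B h
  have : ‖of n Λ (A - B)‖ = 0 := by
    rw [map_sub, h, sub_self, ← map_zero (of n Λ), norm_of, norm_zero]
  rwa [norm_of, norm_eq_zero, sub_eq_zero] at this

instance : NormedRing (LocalObs n) :=
  { (inferInstance : Ring (LocalObs n)),
    NormedAddCommGroup.ofCore (𝕜 := ℂ) (E := LocalObs n)
      { norm_nonneg := fun x => by
          obtain ⟨Λ, A, rfl⟩ := exists_of n x
          exact norm_nonneg A
        norm_smul := fun c x => by
          obtain ⟨Λ, A, rfl⟩ := exists_of n x
          rw [← map_smul, norm_of, norm_of, norm_smul]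
        norm_triangle := fun x y => by
          obtain ⟨Λ, A, B, rfl, rfl⟩ := exists_of₂ n x y
          rw [← map_add, norm_of, norm_of, norm_of]
          exact norm_add_le A B
        norm_eq_zero_iff := fun x => by
          obtain ⟨Λ, A, rfl⟩ := exists_of n x
          rw [norm_of, norm_eq_zero, map_eq_zero_iff _ (of_injective n Λ)] } with
    norm_mul_le := fun x y => by
      obtain ⟨Λ, A, B, rfl, rfl⟩ := exists_of₂ n x y
      change ‖of n Λ A * of n Λ B‖ ≤ ‖of n Λ A‖ * ‖of n Λ B‖
      rw [← map_mul, norm_of, norm_of, norm_of]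
      exact norm_mul_le A B }

instance : NormedAlgebra ℂ (LocalObs n) where
  norm_smul_le c x := by
    obtain ⟨Λ, A, rfl⟩ := exists_of n x
    rw [← map_smul, norm_of, norm_of, norm_smul]

instance : CStarRing (LocalObs n) where
  norm_mul_self_le x := by
    obtain ⟨Λ, A, rfl⟩ := exists_of n x
    rw [← map_star, ← map_mul, norm_of, norm_of]
    exact CStarRing.norm_mul_self_le A

end LocalObs

/-- The quasi-local algebra `𝔸`: the norm completion of the local observables. -/
def QuasiLocal (n : Lattice d → ℕ) [∀ j, NeZero (n j)] : Type :=
  UniformSpace.Completion (LocalObs n)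

namespace QuasiLocal

open UniformSpace

variable (n : Lattice d → ℕ) [∀ j, NeZero (n j)]

instance : NormedRing (QuasiLocal n) :=
  inferInstanceAs (NormedRing (Completion (LocalObs n)))

instance : CompleteSpace (QuasiLocal n) :=
  inferInstanceAs (CompleteSpace (Completion (LocalObs n)))

instance : Algebra ℂ (QuasiLocal n) :=
  inferInstanceAs (Algebra ℂ (Completion (LocalObs n)))

instance : NormedAlgebra ℂ (QuasiLocal n) where
  norm_smul_le c x := by
    exact norm_smul_le (β := Completion (LocalObs n)) c x

/-- The inclusion `𝔸_loc → 𝔸`. -/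
def coe : LocalObs n →ₐ[ℂ] QuasiLocal n :=
  { (Completion.coeRingHom : LocalObs n →+* Completion (LocalObs n)) with
    commutes' := fun _ => rfl }

theorem denseRange_coe : DenseRange (coe n) := Completion.denseRange_coe

theorem norm_coe (x : LocalObs n) : ‖coe n x‖ = ‖x‖ := Completion.norm_coe x

theorem continuous_coe : Continuous (coe n) := Completion.continuous_coe _

/-- The involution of `𝔸` extends the one of `𝔸_loc` by continuity. -/
instance : Star (QuasiLocal n) where
  star := Completion.map (star : LocalObs n → LocalObs n)

theorem star_coe (x : LocalObs n) : star (coe n x) = coe n (star x) :=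
  Completion.map_coe star_isometry.uniformContinuous x

theorem continuous_star' : Continuous (star : QuasiLocal n → QuasiLocal n) :=
  Completion.continuous_map

instance : StarRing (QuasiLocal n) where
  star_involutive x := by
    refine (denseRange_coe n).induction_on x
      (isClosed_eq ((continuous_star' n).comp (continuous_star' n)) continuous_id) fun a => ?_
    simp only [star_coe, star_star]
  star_mul x y := by
    refine (denseRange_coe n).induction_on₂ (isClosed_eq
      ((continuous_star' n).comp (continuous_fst.mul continuous_snd))
      (((continuous_star' n).comp continuous_snd).mul ((continuous_star' n).comp continuous_fst)))
      (fun a b => ?_) x y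
    simp only [star_coe, ← map_mul, star_mul]
  star_add x y := by
    refine (denseRange_coe n).induction_on₂ (isClosed_eq
      ((continuous_star' n).comp (continuous_fst.add continuous_snd))
      (((continuous_star' n).comp continuous_fst).add ((continuous_star' n).comp continuous_snd)))
      (fun a b => ?_) x y
    simp only [star_coe, ← map_add, star_add]

instance : StarModule ℂ (QuasiLocal n) where
  star_smul c x := by
    refine (denseRange_coe n).induction_on x
      (isClosed_eq ((continuous_star' n).comp (continuous_const_smul c))
        ((continuous_star' n).const_smul (star c))) fun a => ?_
    simp only [star_coe, ← map_smul, star_smul]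

instance : CStarRing (QuasiLocal n) where
  norm_mul_self_le x := by
    refine (denseRange_coe n).induction_on x
      (isClosed_le (continuous_norm.mul continuous_norm)
        (continuous_norm.comp ((continuous_star' n).mul continuous_id))) fun a => ?_
    simp only [star_coe, ← map_mul, norm_coe]
    exact CStarRing.norm_mul_self_le a

instance : CStarAlgebra (QuasiLocal n) where

/-- The canonical map `𝔸(Λ) → 𝔸`. -/
def of (Λ : Finset (Lattice d)) : RegionAlg n Λ →⋆ₐ[ℂ] QuasiLocal n :=
  { (coe n).comp (LocalObs.of n Λ).toAlgHom with
    map_star' := fun A => by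
      change coe n (LocalObs.of n Λ (star A)) = star (coe n (LocalObs.of n Λ A))
      rw [star_coe, map_star] }

end QuasiLocal

/-- The subalgebra `𝔸(Λ) ⊆ 𝔸` of observables supported in the finite region `Λ`. -/
def localAlg (n : Lattice d → ℕ) [∀ j, NeZero (n j)] (Λ : Finset (Lattice d)) :
    StarSubalgebra ℂ (QuasiLocal n) :=
  (QuasiLocal.of n Λ).range

/-! ## Euclidean geometry of `ℤ^d` -/

/-- The Euclidean distance `d(i,j)` on `ℤ^d`. -/
def latticeDist (i j : Lattice d) : ℝ≥0 :=
  NNReal.sqrt (∑ a, ((i a - j a).natAbs : ℝ≥0) ^ 2)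

open scoped Classical in
/-- The ball `B_p(r) = {i : d(p,i) ≤ r - 1}`; in particular `B_p(0) = ∅` and `B_p(1) = {p}`. -/
def ball (p : Lattice d) (r : ℕ) : Finset (Lattice d) :=
  (Finset.Icc (fun a => p a - (r : ℤ)) (fun a => p a + (r : ℤ))).filter
    fun i => latticeDist p i + 1 ≤ (r : ℝ≥0)

theorem mem_ball {p i : Lattice d} {r : ℕ} :
    i ∈ ball p r ↔ latticeDist p i + 1 ≤ (r : ℝ≥0) := by
  classical
  refine ⟨fun h => (Finset.mem_filter.1 h).2, fun h => Finset.mem_filter.2 ⟨?_, h⟩⟩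
  have key : ∀ a, (p a - i a).natAbs ≤ r := fun a => by
    have h1 : ((p a - i a).natAbs : ℝ≥0) ≤ latticeDist p i := by
      rw [latticeDist, NNReal.le_sqrt_iff_sq_le]
      exact Finset.single_le_sum (f := fun a => ((p a - i a).natAbs : ℝ≥0) ^ 2)
        (fun _ _ => zero_le) (Finset.mem_univ a)
    exact_mod_cast h1.trans (le_self_add.trans h)
  refine Finset.mem_Icc.2 ⟨fun a => ?_, fun a => ?_⟩ <;> have := key a <;> simp only <;> omega

/-- `K_d`: the best constant in the boundary bound `|∂B_j(r+1)| ≤ K_d r^{d-1}` for all `r ≥ 1` and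
`j ∈ ℤ^d`, where `∂B_j(r+1) = B_j(r+1) \ B_j(r)`. -/
def shellConst (d : ℕ) : ℝ :=
  sInf {K : ℝ | 0 < K ∧ ∀ (j : Lattice d) (r : ℕ), 1 ≤ r →
    ((ball j (r + 1) \ ball j r).card : ℝ) ≤ K * (r : ℝ) ^ (d - 1)}

/-! ## Decay functions -/

/-- Rapidly decaying sequences: `sup_r (1+r)^k |f r| < ∞` for every `k`. -/
def RapidDecay (f : ℕ → ℝ) : Prop :=
  ∀ k : ℕ, BddAbove (Set.range fun r : ℕ => (1 + (r : ℝ)) ^ k * |f r|)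

/-- The nonnegative, nonincreasing, rapidly decaying sequences. -/
def IsTail (f : ℕ → ℝ) : Prop :=
  (∀ r, 0 ≤ f r) ∧ Antitone f ∧ RapidDecay f

/-- `F` is a reproducing function for `ℤ^d`: uniform integrability and the convolution condition.
Sums and quotients are taken in `[0,∞]`, where `0 / 0 = 0` and `a / 0 = ∞` for `a ≠ 0`. -/
def IsReproducing (d : ℕ) (F : ℝ≥0 → ℝ≥0) : Prop :=
  (⨆ x : Lattice d, ∑' y : Lattice d, (F (latticeDist x y) : ℝ≥0∞)) < ∞ ∧
  (⨆ (x : Lattice d) (y : Lattice d), ∑' z : Lattice d,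
    (F (latticeDist x z) : ℝ≥0∞) * F (latticeDist z y) / F (latticeDist x y)) < ∞

/-- `g_F(t) = ∑_{k,l ≥ 1} (t+k+l-1)^{d-1} F(t+k+l-2) ∈ [0,∞]`, with `k`, `l` shifted to start
at `0`. -/
def gF (d : ℕ) (F : ℝ≥0 → ℝ≥0) (t : ℕ) : ℝ≥0∞ :=
  ∑' (k : ℕ) (l : ℕ), ((t + k + l + 1 : ℕ) : ℝ≥0∞) ^ (d - 1) * F ((t + k + l : ℕ) : ℝ≥0)

/-- `f_F = K_d² g_F` (meaningful where `g_F` is finite). -/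
def fF (d : ℕ) (F : ℝ≥0 → ℝ≥0) (r : ℕ) : ℝ :=
  shellConst d ^ 2 * (gF d F r).toReal

/-! ## Locality of automorphisms -/

/-- `B` is `ε`-contained in `C`: every `A ∈ B` admits `A' ∈ C` with `‖A - A'‖ ≤ ε ‖A‖`. -/
def NearContained {𝔄 : Type*} [CStarAlgebra 𝔄] (ε : ℝ) (B C : StarSubalgebra ℂ 𝔄) : Prop :=
  ∀ A ∈ B, ∃ A' ∈ C, ‖A - A'‖ ≤ ε * ‖A‖

variable {n : Lattice d → ℕ} [∀ j, NeZero (n j)]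

/-- The Lieb–Robinson bound with decay function `F`, for all finite regions. -/
def LiebRobinsonBound (F : ℝ≥0 → ℝ≥0) (α : QuasiLocal n ≃⋆ₐ[ℂ] QuasiLocal n) : Prop :=
  ∀ Λ₁ Λ₂ : Finset (Lattice d), ∀ A ∈ localAlg n Λ₁, ∀ B ∈ localAlg n Λ₂,
    ‖α A * B - B * α A‖ ≤
      ‖A‖ * ‖B‖ * ∑ i ∈ Λ₁, ∑ j ∈ Λ₂, (F (latticeDist i j) : ℝ)

/-- `α` is approximately locality preserving with `f`-tails: `f` is nonnegative, nonincreasing and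
rapidly decaying, and `α(𝔸(B_p(s)))` is `s^{d-1} f(r)`-contained in `𝔸(B_p(s+r))`. -/
def HasTails (α : QuasiLocal n ≃⋆ₐ[ℂ] QuasiLocal n) (f : ℕ → ℝ) : Prop :=
  IsTail f ∧ ∀ (p : Lattice d) (s r : ℕ), 1 ≤ s →
    NearContained ((s : ℝ) ^ (d - 1) * f r)
      ((localAlg n (ball p s)).map (α : QuasiLocal n →⋆ₐ[ℂ] QuasiLocal n))
      (localAlg n (ball p (s + r)))

/-- `H_α(s,r)`, the supremum over `p` and over `A ∈ 𝔸(B_p(s))` of norm one of the distance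
from `α(A)` to `𝔸(B_p(s+r))`; by convention `H_α(s,0) = 1`. -/
def spread (α : QuasiLocal n ≃⋆ₐ[ℂ] QuasiLocal n) (s r : ℕ) : ℝ≥0∞ :=
  if r = 0 then 1 else
    ⨆ (p : Lattice d) (A : QuasiLocal n) (_ : A ∈ localAlg n (ball p s)) (_ : ‖A‖ = 1),
      Metric.infEDist (α A) (localAlg n (ball p (s + r)) : Set (QuasiLocal n))

/-- `α` is almost locality preserving: `H_α(s,r) ≤ s^{d-1} f(r)` with `f` rapidly decaying. -/
def IsALP (α : QuasiLocal n ≃⋆ₐ[ℂ] QuasiLocal n) : Prop :=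
  ∃ f : ℕ → ℝ, IsTail f ∧ ∀ s r : ℕ, 1 ≤ s →
    spread α s r ≤ ENNReal.ofReal ((s : ℝ) ^ (d - 1) * f r)

/-! ## Almost local observables -/

/-- `f_r(A) = inf {‖A - B‖ : B ∈ 𝔸(B_0(r))}`. -/
def locErr (A : QuasiLocal n) (r : ℕ) : ℝ :=
  Metric.infDist A (localAlg n (ball 0 r) : Set (QuasiLocal n))

/-- The set `𝔸_∞` of almost local observables. -/
def almostLocal (n : Lattice d → ℕ) [∀ j, NeZero (n j)] : Set (QuasiLocal n) :=
  {A | IsTail (locErr A)}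

/-- The norms `‖A‖ + sup_r (1+r)^k f_r(A)` defining the Fréchet topology of `𝔸_∞`. -/
def frechetNorm (k : ℕ) (A : QuasiLocal n) : ℝ :=
  ‖A‖ + ⨆ r : ℕ, (1 + (r : ℝ)) ^ k * locErr A r

/-- `α` maps `𝔸_∞` into itself and is continuous there for the Fréchet topology. -/
def FrechetContinuous (α : QuasiLocal n ≃⋆ₐ[ℂ] QuasiLocal n) : Prop :=
  Set.MapsTo α (almostLocal n) (almostLocal n) ∧
    ∀ k : ℕ, ∃ (m : ℕ) (C : ℝ), 0 < C ∧
      ∀ A ∈ almostLocal n, frechetNorm k (α A) ≤ C * frechetNorm m A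

end SpinLattice
end

noncomputable section

namespace SpinLattice

variable {d : ℕ}

/-! ## Geometry of balls and shells -/

/-! The containment rests on one principle: an observable that commutes up to `ε` with every unitary
supported in a finite region off `Λ` lies within `ε` of `𝔸(Λ)`
(`exists_mem_localAlg_of_commutator_le`). After a local approximation in some `Δ ⊇ Λ`, conjugate by
unitaries of `𝔸(Δ \ Λ)` and average. Signed permutation matrices suffice, so a finite sum replaces
Haar measure: the signs kill the entries off-diagonal over `Δ \ Λ`, the permutations equalise the
diagonal ones, and an element `C ⊗ 𝟏` remains. As the distance to `𝔸(Λ)` is attained, the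
approximation error can be sent to zero.

The Lieb–Robinson bound then makes `ε` equal to `‖A‖` times a double sum of `F` over `B_p(s)` and a
region `T` outside `B_p(s+r)`. A point in the shell at depth `k` inside `B_p(s)` sees `T` only
beyond distance `r+k`. Summing over shells around that point, and then over the shells of `B_p(s)`,
costs one factor `K_d` each time and gives `s^{d-1} K_d² g_F(r)` (`sum_ball_sum_outside_le`). That
`K_d` is a genuine bound needs the shell count `card_shell_le`.

Rapid decay passes from `F` to `g_F` by spending four extra powers on the double sum. Fréchet
continuity follows by splitting a radius into two nearly equal halves, one for localising `A` and
one for the spreading of `α`. -/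

theorem coe_latticeDist (i j : Lattice d) :
    (latticeDist i j : ℝ) = dist (WithLp.toLp 2 (fun a => (i a : ℝ)) : EuclideanSpace ℝ (Fin d))
      (WithLp.toLp 2 (fun a => (j a : ℝ))) := by
  rw [EuclideanSpace.dist_eq, latticeDist, Real.coe_sqrt]
  congr 1
  push_cast
  refine Finset.sum_congr rfl fun a _ => ?_
  rw [Real.dist_eq, sq_abs, Nat.cast_natAbs]
  push_cast
  rw [sq_abs]

theorem latticeDist_triangle (i j k : Lattice d) :
    latticeDist i k ≤ latticeDist i j + latticeDist j k := by
  rw [← NNReal.coe_le_coe, NNReal.coe_add, coe_latticeDist, coe_latticeDist, coe_latticeDist]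
  exact dist_triangle _ _ _

theorem mem_ball_succ {p i : Lattice d} {r : ℕ} :
    i ∈ ball p (r + 1) ↔ latticeDist p i ≤ r := by
  rw [mem_ball]
  push_cast
  exact add_le_add_iff_right 1

theorem mem_ball_succ_iff_sum_sq {p i : Lattice d} {r : ℕ} :
    i ∈ ball p (r + 1) ↔ ∑ a, (p a - i a) ^ 2 ≤ (r : ℤ) ^ 2 := by
  rw [mem_ball_succ, latticeDist, NNReal.sqrt_le_iff_le_sq]
  have : ∑ a, ((p a - i a).natAbs : ℝ≥0) ^ 2 = ((∑ a, (p a - i a).natAbs ^ 2 : ℕ) : ℝ≥0) := by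
    push_cast; rfl
  rw [this, ← Nat.cast_pow, Nat.cast_le, ← Nat.cast_le (α := ℤ)]
  push_cast
  simp only [sq_abs]

theorem ball_zero (p : Lattice d) : ball p 0 = ∅ := by
  refine Finset.eq_empty_of_forall_notMem fun i hi => ?_
  rw [mem_ball] at hi
  simp at hi

theorem ball_mono (p : Lattice d) : Monotone (ball p) := by
  intro r s hrs i hi
  rw [mem_ball] at hi ⊢
  exact hi.trans (by exact_mod_cast hrs)

theorem exists_subset_ball (p : Lattice d) (T : Finset (Lattice d)) : ∃ N, T ⊆ ball p N := by
  classical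
  induction T using Finset.induction_on with
  | empty => exact ⟨0, Finset.empty_subset _⟩
  | insert i T _ ih =>
    obtain ⟨N, hN⟩ := ih
    obtain ⟨M, hM⟩ := exists_nat_ge (latticeDist p i)
    refine ⟨max N (M + 1), Finset.insert_subset ?_ (hN.trans (ball_mono p (le_max_left _ _)))⟩
    exact ball_mono p (le_max_right _ _) (mem_ball_succ.2 hM)

/-- Two points of a shell that differ only in a coordinate dominating both of them have, in that
coordinate, absolute values differing by less than `d`. -/
theorem sub_lt_of_mem_shell {r t u c D : ℤ} (hD : 1 ≤ D) (ht : 0 ≤ t) (hu : t ≤ u)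
    (hlow : (r - 1) ^ 2 < c + t ^ 2) (hup : c + u ^ 2 ≤ r ^ 2) (hdom : c + t ^ 2 ≤ D * t ^ 2) :
    u - t < D := by
  have h1 : (r - 1) ^ 2 < (D * t) ^ 2 := by nlinarith [sq_nonneg t]
  have h2 : r - 1 < D * t := lt_of_pow_lt_pow_left₀ 2 (by positivity) h1
  have h3 : r ≤ D * t := by omega
  -- If `u - t ≥ D`, then `u² - t² ≥ D(u + t) ≥ 2Dt ≥ 2r`, whereas the shell leaves room for at most
  -- `2r - 1`.
  by_contra! h
  have h4 : (u - t) * (u + t) ≤ 2 * r - 1 := by nlinarith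
  have h5 : D * (u + t) ≤ (u - t) * (u + t) := mul_le_mul_of_nonneg_right h (by omega)
  nlinarith

/-- Sort the points by a coordinate `a` of largest displacement from `j` and forget that coordinate.
The projections lie in a box of dimension `d - 1`. A fibre is short because the sphere is steep in a
dominant direction: the displacement has at most `d` absolute values and two signs. -/
theorem card_shell_le (hd : 1 ≤ d) (j : Lattice d) (r : ℕ) (hr : 1 ≤ r) :
    (ball j (r + 1) \ ball j r).card ≤ d * (2 * d * (2 * r + 1) ^ (d - 1)) := by
  classical
  set S := ball j (r + 1) \ ball j r with hS
  have hmem : ∀ x ∈ S, ∑ a, (j a - x a) ^ 2 ≤ (r : ℤ) ^ 2 ∧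
      ((r : ℤ) - 1) ^ 2 < ∑ a, (j a - x a) ^ 2 := by
    intro x hx
    rw [hS, Finset.mem_sdiff] at hx
    refine ⟨mem_ball_succ_iff_sum_sq.1 hx.1, ?_⟩
    obtain ⟨q, rfl⟩ : ∃ q, r = q + 1 := ⟨r - 1, by omega⟩
    have := hx.2
    rw [mem_ball_succ_iff_sum_sq] at this
    push_cast
    simpa using this
  let Sa : Fin d → Finset (Lattice d) := fun a =>
    S.filter fun x => ∀ b, (j b - x b) ^ 2 ≤ (j a - x a) ^ 2
  have hcover : S ⊆ Finset.univ.biUnion Sa := by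
    intro x hx
    have : Nonempty (Fin d) := ⟨⟨0, hd⟩⟩
    obtain ⟨a, ha⟩ := Finite.exists_max fun b => (j b - x b) ^ 2
    exact Finset.mem_biUnion.2 ⟨a, Finset.mem_univ _, Finset.mem_filter.2 ⟨hx, ha⟩⟩
  refine (Finset.card_le_card hcover).trans ?_
  refine (Finset.card_biUnion_le_card_mul _ _ (2 * d * (2 * r + 1) ^ (d - 1)) ?_).trans (by simp)
  intro a _
  let f : Lattice d → Lattice d := fun x => Function.update x a (j a)
  have himage : ((Sa a).image f).card ≤ (2 * r + 1) ^ (d - 1) := by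
    have hsub : (Sa a).image f ⊆ Fintype.piFinset fun b =>
        if b = a then {j a} else Finset.Icc (j b - r) (j b + r) := by
      intro y hy
      obtain ⟨x, hx, rfl⟩ := Finset.mem_image.1 hy
      refine Fintype.mem_piFinset.2 fun b => ?_
      by_cases hb : b = a
      · subst hb; simp [f]
      · simp only [f, hb, if_false, Function.update_of_ne hb, Finset.mem_Icc]
        have h1 : (j b - x b) ^ 2 ≤ (r : ℤ) ^ 2 :=
          (Finset.single_le_sum (f := fun b => (j b - x b) ^ 2) (fun _ _ => sq_nonneg _)
            (Finset.mem_univ b)).trans (hmem x (Finset.mem_filter.1 hx).1).1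
        have h2 := abs_le.1 (abs_le_of_sq_le_sq h1 (by positivity))
        omega
    refine (Finset.card_le_card hsub).trans ?_
    rw [Fintype.card_piFinset, ← Finset.mul_prod_erase _ _ (Finset.mem_univ a),
      Finset.prod_congr rfl (g := fun _ => 2 * r + 1)]
    · simp
    · intro b hb
      rw [if_neg (Finset.ne_of_mem_erase hb), Int.card_Icc]
      omega
  refine (Finset.card_le_mul_card_image (f := f) (Sa a) (2 * d) ?_).trans
    (Nat.mul_le_mul_left _ himage)
  intro y _
  set T := (Sa a).filter fun x => f x = y with hT
  rcases T.eq_empty_or_nonempty with h0 | hne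
  · rw [h0]; simp
  -- The fibre point with least displacement is the base point: dominance of `a` is needed only
  -- there, and every other fibre point is compared with it.
  obtain ⟨x₀, hx₀, hmin⟩ := T.exists_min_image (fun x => (j a - x a).natAbs) hne
  set t := (j a - x₀ a).natAbs with ht
  have hsplit : ∀ x : Lattice d, ∑ b, (j b - x b) ^ 2 =
      ∑ b ∈ Finset.univ.erase a, (j b - f x b) ^ 2 + ((j a - x a).natAbs : ℤ) ^ 2 := by
    intro x
    rw [← Finset.sum_erase_add _ _ (Finset.mem_univ a), Int.natCast_natAbs, sq_abs]
    congr 1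
    refine Finset.sum_congr rfl fun b hb => ?_
    simp only [f, Function.update_of_ne (Finset.ne_of_mem_erase hb)]
  have hrange : ∀ x ∈ T, (j a - x a).natAbs ∈ Finset.Ico t (t + d) := by
    intro x hx
    have hx' := Finset.mem_filter.1 hx
    have hx₀' := Finset.mem_filter.1 hx₀
    have hxS := hmem x (Finset.mem_filter.1 hx'.1).1
    have hx₀S := hmem x₀ (Finset.mem_filter.1 hx₀'.1).1
    have hdom : ∑ b, (j b - x₀ b) ^ 2 ≤ (d : ℤ) * (t : ℤ) ^ 2 := by
      have := Finset.sum_le_card_nsmul Finset.univ (fun b => (j b - x₀ b) ^ 2) _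
        fun b _ => (Finset.mem_filter.1 hx₀'.1).2 b
      simpa [ht] using this
    rw [hsplit, hx'.2] at hxS
    rw [hsplit, hx₀'.2] at hx₀S hdom
    have hle := hmin x hx
    have := sub_lt_of_mem_shell (r := r) (D := d) (t := t)
      (by exact_mod_cast hd) (by positivity) (by exact_mod_cast hle) hx₀S.2 hxS.1 hdom
    rw [Finset.mem_Ico]
    omega
  let g : Lattice d → ℕ × Bool := fun x => ((j a - x a).natAbs, decide (0 ≤ j a - x a))
  have hg : T.card ≤ (Finset.Ico t (t + d) ×ˢ (Finset.univ : Finset Bool)).card := by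
    refine Finset.card_le_card_of_injOn g
      (fun x hx => Finset.mem_product.2 ⟨hrange x hx, Finset.mem_univ _⟩) ?_
    intro x hx x' hx' h
    have hxy := (Finset.mem_filter.1 hx).2.trans (Finset.mem_filter.1 hx').2.symm
    funext b
    by_cases hb : b = a
    · subst hb
      simp only [g, Prod.mk.injEq, decide_eq_decide] at h
      omega
    · simpa [f, Function.update_of_ne hb] using congrFun hxy b
  refine hg.trans (le_of_eq ?_)
  simp [mul_comm]

theorem shellConst_set_nonempty (hd : 1 ≤ d) :
    {K : ℝ | 0 < K ∧ ∀ (j : Lattice d) (r : ℕ), 1 ≤ r →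
      ((ball j (r + 1) \ ball j r).card : ℝ) ≤ K * (r : ℝ) ^ (d - 1)}.Nonempty := by
  refine ⟨d * (2 * d * 3 ^ (d - 1)), by positivity, fun j r hr => ?_⟩
  have h1 : ((ball j (r + 1) \ ball j r).card : ℝ) ≤ d * (2 * d * (2 * r + 1) ^ (d - 1)) := by
    exact_mod_cast card_shell_le hd j r hr
  have hr' : (1 : ℝ) ≤ r := by exact_mod_cast hr
  refine h1.trans ?_
  rw [show (d : ℝ) * (2 * d * 3 ^ (d - 1)) * (r : ℝ) ^ (d - 1) =
    d * (2 * d * (3 * r) ^ (d - 1)) by rw [mul_pow]; ring]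
  gcongr
  linarith

theorem shellConst_nonneg : 0 ≤ shellConst d := Real.sInf_nonneg fun _ h => h.1.le

theorem card_shell_le_shellConst (hd : 1 ≤ d) (j : Lattice d) (r : ℕ) (hr : 1 ≤ r) :
    ((ball j (r + 1) \ ball j r).card : ℝ) ≤ shellConst d * (r : ℝ) ^ (d - 1) := by
  have hr' : (0 : ℝ) < (r : ℝ) ^ (d - 1) := by
    have : (0 : ℝ) < r := by exact_mod_cast hr
    positivity
  rw [← div_le_iff₀ hr']
  refine le_csInf (shellConst_set_nonempty hd) fun K hK => ?_
  rw [div_le_iff₀ hr']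
  exact hK.2 j r hr

/-- The shell for `r = 1` contains a unit vector. This serves the innermost shell `{p}`, which the
defining inequality of `K_d` leaves out because it starts at `r = 1`. -/
theorem one_le_shellConst (hd : 1 ≤ d) : 1 ≤ shellConst d := by
  refine le_trans ?_ ((card_shell_le_shellConst hd 0 1 le_rfl).trans (by simp))
  rw [Nat.one_le_cast, Nat.one_le_iff_ne_zero, Finset.card_ne_zero]
  refine ⟨Pi.single ⟨0, hd⟩ 1, Finset.mem_sdiff.2 ⟨?_, ?_⟩⟩
  · rw [mem_ball_succ_iff_sum_sq, Finset.sum_eq_single ⟨0, hd⟩] <;> simp +contextual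
  · rw [← zero_add 1, mem_ball_succ_iff_sum_sq, Finset.sum_eq_single ⟨0, hd⟩] <;>
      simp +contextual

theorem card_shell_le_of_lt (hd : 1 ≤ d) (p : Lattice d) {u s : ℕ} (hu : u < s) :
    ((ball p (u + 1) \ ball p u).card : ℝ) ≤ shellConst d * (s : ℝ) ^ (d - 1) := by
  rcases Nat.eq_zero_or_pos u with rfl | hu0
  · have h1 : ball p (0 + 1) \ ball p 0 ⊆ {p} := by
      intro i hi
      have := (mem_ball_succ_iff_sum_sq.1 (Finset.mem_sdiff.1 hi).1)
      have h0 : ∑ a, (p a - i a) ^ 2 = 0 :=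
        le_antisymm (by simpa using this) (Finset.sum_nonneg fun _ _ => sq_nonneg _)
      rw [Finset.sum_eq_zero_iff_of_nonneg fun _ _ => sq_nonneg _] at h0
      rw [Finset.mem_singleton]
      funext a
      have := pow_eq_zero_iff (two_ne_zero) |>.1 (h0 a (Finset.mem_univ a))
      omega
    have h2 : ((ball p (0 + 1) \ ball p 0).card : ℝ) ≤ 1 := by
      exact_mod_cast Finset.card_le_card h1
    have hs : (1 : ℝ) ≤ (s : ℝ) ^ (d - 1) := one_le_pow₀ (by exact_mod_cast hu)
    nlinarith [one_le_shellConst hd]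
  · refine (card_shell_le_shellConst hd p u hu0).trans ?_
    have := shellConst_nonneg (d := d)
    gcongr

/-- A sum over a ball, shell by shell. -/
theorem sum_ball_eq_sum_shell (p : Lattice d) (G : Lattice d → ℝ) (s : ℕ) :
    ∑ i ∈ ball p s, G i = ∑ u ∈ Finset.range s, ∑ i ∈ ball p (u + 1) \ ball p u, G i := by
  induction s with
  | zero => simp [ball_zero]
  | succ s ih =>
    rw [Finset.sum_range_succ, ← ih, ← Finset.sum_sdiff (ball_mono p (Nat.le_succ s)), add_comm]

/-! ### Sums of `F` between a ball and a distant region -/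

variable {F : ℝ≥0 → ℝ≥0}

/-- Points of `B_i(m+l+2) \ B_i(m+l+1)` are at distance more than `m+l`, so monotonicity bounds each
term by `F(m+l)`, and there are at most `K_d (m+l+1)^{d-1}` of them. The induction peels off the
outermost shell. -/
theorem sum_ball_sdiff_le (hd : 1 ≤ d) (hF : Antitone F) (i : Lattice d) (m N : ℕ) :
    ∑ j ∈ ball i (m + 1 + N) \ ball i (m + 1), (F (latticeDist i j) : ℝ) ≤
      shellConst d * ∑ l ∈ Finset.range N, ((m + l + 1 : ℕ) : ℝ) ^ (d - 1) * F ((m + l : ℕ)) := by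
  induction N with
  | zero => simp
  | succ N ih =>
    rw [Finset.sum_range_succ, mul_add]
    have hsub : ball i (m + 1 + (N + 1)) \ ball i (m + 1) ⊆
        (ball i (m + 1 + N) \ ball i (m + 1)) ∪
          (ball i (m + N + 1 + 1) \ ball i (m + N + 1)) := by
      intro j hj
      rw [show m + 1 + (N + 1) = m + N + 1 + 1 by ring] at hj
      rw [show m + 1 + N = m + N + 1 by ring]
      simp only [Finset.mem_union, Finset.mem_sdiff] at hj ⊢
      tauto
    refine (Finset.sum_le_sum_of_subset_of_nonneg hsub fun _ _ _ => NNReal.coe_nonneg _).trans ?_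
    have hdisj : Disjoint (ball i (m + 1 + N) \ ball i (m + 1))
        (ball i (m + N + 1 + 1) \ ball i (m + N + 1)) := by
      rw [show m + 1 + N = m + N + 1 by ring]
      exact Finset.disjoint_sdiff.mono_left Finset.sdiff_subset
    rw [Finset.sum_union hdisj]
    refine add_le_add ih ?_
    have hterm : ∀ j ∈ ball i (m + N + 1 + 1) \ ball i (m + N + 1),
        (F (latticeDist i j) : ℝ) ≤ F ((m + N : ℕ)) := by
      intro j hj
      have := (Finset.mem_sdiff.1 hj).2
      rw [mem_ball_succ, not_le] at this
      exact_mod_cast hF this.le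
    refine (Finset.sum_le_card_nsmul _ _ _ hterm).trans ?_
    rw [nsmul_eq_mul, ← mul_assoc]
    gcongr
    exact card_shell_le_shellConst hd i (m + N + 1) (by omega)

theorem sum_outside_ball_le (hd : 1 ≤ d) (hF : Antitone F) {i : Lattice d} {m : ℕ}
    {T : Finset (Lattice d)} (hT : Disjoint T (ball i (m + 1))) :
    ENNReal.ofReal (∑ j ∈ T, (F (latticeDist i j) : ℝ)) ≤
      ENNReal.ofReal (shellConst d) *
        ∑' l : ℕ, ((m + l + 1 : ℕ) : ℝ≥0∞) ^ (d - 1) * F ((m + l : ℕ) : ℝ≥0) := by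
  obtain ⟨N, hN⟩ := exists_subset_ball i T
  have hsub : T ⊆ ball i (m + 1 + N) \ ball i (m + 1) := by
    rw [Finset.subset_sdiff]
    exact ⟨hN.trans (ball_mono i (by omega)), hT⟩
  refine (ENNReal.ofReal_le_ofReal
    ((Finset.sum_le_sum_of_subset_of_nonneg hsub fun _ _ _ => NNReal.coe_nonneg _).trans
      (sum_ball_sdiff_le hd hF i m N))).trans ?_
  rw [ENNReal.ofReal_mul shellConst_nonneg]
  gcongr
  rw [ENNReal.ofReal_sum_of_nonneg fun _ _ => by positivity]
  refine le_trans (le_of_eq ?_) (ENNReal.sum_le_tsum (Finset.range N))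
  refine Finset.sum_congr rfl fun l _ => ?_
  rw [ENNReal.ofReal_mul (by positivity), ENNReal.ofReal_pow (by positivity),
    ENNReal.ofReal_natCast, ENNReal.ofReal_coe_nnreal]

/-- Triangle inequality: `u + (r + (s-1-u)) = s+r-1`, which is exactly the radius of `B_p(s+r)`. -/
theorem disjoint_ball_of_mem_shell {p i : Lattice d} {s r u : ℕ} (hu : u < s)
    {T : Finset (Lattice d)} (hT : Disjoint T (ball p (s + r))) (hi : i ∈ ball p (u + 1)) :
    Disjoint T (ball i (r + (s - 1 - u) + 1)) := by
  rw [Finset.disjoint_left] at hT ⊢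
  intro j hj hji
  refine hT hj ?_
  obtain ⟨q, rfl⟩ : ∃ q, s = q + 1 := ⟨s - 1, by omega⟩
  rw [show q + 1 + r = q + r + 1 by ring]
  rw [mem_ball_succ] at *
  refine (latticeDist_triangle p i j).trans ((add_le_add hi hji).trans ?_)
  rw [← Nat.cast_add, Nat.cast_le]
  omega

theorem sum_ball_sum_outside_le (hd : 1 ≤ d) (hF : Antitone F) {r : ℕ} (hg : gF d F r < ∞)
    (p : Lattice d) (s : ℕ) {T : Finset (Lattice d)} (hT : Disjoint T (ball p (s + r))) :
    ∑ i ∈ ball p s, ∑ j ∈ T, (F (latticeDist i j) : ℝ) ≤ (s : ℝ) ^ (d - 1) * fF d F r := by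
  have hK := shellConst_nonneg (d := d)
  -- `c k` is the inner sum of `g_F(r)`; the index `k = s-1-u` is the depth of the shell `u` below
  -- the surface of `B_p(s)`.
  let c : ℕ → ℝ≥0∞ := fun k =>
    ∑' l : ℕ, ((r + k + l + 1 : ℕ) : ℝ≥0∞) ^ (d - 1) * F ((r + k + l : ℕ) : ℝ≥0)
  have hc : ∑ k ∈ Finset.range s, c k ≤ gF d F r := ENNReal.sum_le_tsum _
  have hcfin : ∀ k, c k < ∞ := fun k => (ENNReal.le_tsum k).trans_lt hg
  have hin : ∀ u ∈ Finset.range s, ∀ i ∈ ball p (u + 1) \ ball p u,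
      ∑ j ∈ T, (F (latticeDist i j) : ℝ) ≤ shellConst d * (c (s - 1 - u)).toReal := by
    intro u hu i hi
    have := sum_outside_ball_le hd hF
      (disjoint_ball_of_mem_shell (Finset.mem_range.1 hu) hT (Finset.mem_sdiff.1 hi).1)
    change _ ≤ _ * c (s - 1 - u) at this
    rw [← ENNReal.ofReal_toReal (hcfin (s - 1 - u)).ne, ← ENNReal.ofReal_mul hK] at this
    exact (ENNReal.ofReal_le_ofReal_iff (by positivity)).1 this
  rw [sum_ball_eq_sum_shell]
  calc ∑ u ∈ Finset.range s, ∑ i ∈ ball p (u + 1) \ ball p u,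
        ∑ j ∈ T, (F (latticeDist i j) : ℝ)
      ≤ ∑ u ∈ Finset.range s, (shellConst d * (s : ℝ) ^ (d - 1)) *
          (shellConst d * (c (s - 1 - u)).toReal) := by
        refine Finset.sum_le_sum fun u hu => ?_
        refine (Finset.sum_le_card_nsmul _ _ _ (hin u hu)).trans ?_
        rw [nsmul_eq_mul]
        gcongr
        exact card_shell_le_of_lt hd p (Finset.mem_range.1 hu)
    _ = (s : ℝ) ^ (d - 1) * (shellConst d ^ 2 * (∑ k ∈ Finset.range s, c k).toReal) := by
        rw [← Finset.mul_sum, ← Finset.mul_sum,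
          Finset.sum_range_reflect (fun k => (c k).toReal) s,
          ENNReal.toReal_sum fun k _ => (hcfin k).ne]
        ring
    _ ≤ (s : ℝ) ^ (d - 1) * fF d F r := by
        unfold fF
        gcongr
        exact hg.ne

/-! ## Signed permutation matrices -/

section SignedPerm

variable {m : Type*} [Fintype m] [DecidableEq m]

/-- The signed permutation matrix sending the basis vector `π x` to `ε x` times that of `x`. -/
def signedPerm (g : (m → ℤˣ) × Equiv.Perm m) : Matrix m m ℂ :=
  Matrix.of fun x y => if y = g.2 x then ((g.1 x : ℤ) : ℂ) else 0

theorem signedPerm_mem_unitary (g : (m → ℤˣ) × Equiv.Perm m) :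
    signedPerm g ∈ unitary (Matrix m m ℂ) := by
  have h : signedPerm g * star (signedPerm g) = 1 := by
    ext x y
    rw [Matrix.mul_apply, Matrix.one_apply]
    simp only [signedPerm, Matrix.of_apply, Matrix.star_apply, ite_mul, zero_mul,
      Finset.sum_ite_eq', Finset.mem_univ, if_true, EmbeddingLike.apply_eq_iff_eq]
    split_ifs with hxy
    · subst hxy
      rw [star_intCast]
      exact_mod_cast Int.units_coe_mul_self (g.1 x)
    · simp
  exact Unitary.mem_iff.2 ⟨mul_eq_one_comm.1 h, h⟩

/-- Flipping the sign at `x` alone permutes the sign patterns and negates every summand. -/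
theorem sum_sign_mul_sign {x y : m} (hxy : x ≠ y) :
    ∑ ε : m → ℤˣ, ((ε x : ℤ) : ℂ) * ((ε y : ℤ) : ℂ) = 0 := by
  have h : ∑ ε : m → ℤˣ, ((ε x : ℤ) : ℂ) * ((ε y : ℤ) : ℂ) =
      ∑ ε : m → ℤˣ, -(((ε x : ℤ) : ℂ) * ((ε y : ℤ) : ℂ)) := by
    refine Fintype.sum_equiv (Equiv.mulLeft (Pi.mulSingle x (-1))) _ _ fun ε => ?_
    simp [Pi.mulSingle_eq_of_ne hxy.symm]
  rw [Finset.sum_neg_distrib] at h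
  exact self_eq_neg.1 h

theorem sum_perm_apply_eq (f : m → ℂ) (x y : m) :
    ∑ π : Equiv.Perm m, f (π x) = ∑ π : Equiv.Perm m, f (π y) := by
  refine Fintype.sum_equiv (Equiv.mulRight (Equiv.swap x y)) _ _ fun π => ?_
  simp

end SignedPerm

/-! ## Averaging over the unitaries of a complementary region -/

/-- A configuration on `Δ ⊇ Λ` as a pair of configurations on `Λ` and on `Δ \ Λ`. -/
def configEquiv (n : Lattice d → ℕ) {Λ Δ : Finset (Lattice d)} (h : Λ ≤ Δ) :
    Config n Δ ≃ Config n Λ × Config n (Δ \ Λ) where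
  toFun σ := (fun j => σ ⟨j.1, h j.2⟩, fun j => σ ⟨j.1, (Finset.mem_sdiff.1 j.2).1⟩)
  invFun c j := if hj : j.1 ∈ Λ then c.1 ⟨j.1, hj⟩ else c.2 ⟨j.1, Finset.mem_sdiff.2 ⟨j.2, hj⟩⟩
  left_inv σ := by
    funext j
    by_cases hj : j.1 ∈ Λ <;> simp [hj]
  right_inv c := by
    ext j
    · simp
    · have := (Finset.mem_sdiff.1 j.2).2
      simp [this]

section Average

variable (n : Lattice d → ℕ) {Λ Δ : Finset (Lattice d)} (h : Λ ≤ Δ)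

theorem embed_apply_configEquiv (A : RegionAlg n Λ) (σ τ : Config n Δ) :
    embed n h A σ τ = if (configEquiv n h σ).2 = (configEquiv n h τ).2 then
      A (configEquiv n h σ).1 (configEquiv n h τ).1 else 0 := by
  rw [embed_apply, mul_ite, mul_one, mul_zero]
  refine if_congr ?_ rfl rfl
  simp only [configEquiv, Equiv.coe_fn_mk, funext_iff]
  exact ⟨fun H j => H ⟨j.1, (Finset.mem_sdiff.1 j.2).1⟩ (Finset.mem_sdiff.1 j.2).2,
    fun H j hj => H ⟨j.1, Finset.mem_sdiff.2 ⟨j.2, hj⟩⟩⟩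

theorem embed_sdiff_apply_configEquiv (B : RegionAlg n (Δ \ Λ)) (σ τ : Config n Δ) :
    embed n (Finset.sdiff_subset : Δ \ Λ ≤ Δ) B σ τ =
      if (configEquiv n h σ).1 = (configEquiv n h τ).1 then
        B (configEquiv n h σ).2 (configEquiv n h τ).2 else 0 := by
  rw [embed_apply, mul_ite, mul_one, mul_zero]
  refine if_congr ?_ rfl rfl
  simp only [configEquiv, Equiv.coe_fn_mk, funext_iff]
  exact ⟨fun H j => H ⟨j.1, h j.2⟩ fun hj => (Finset.mem_sdiff.1 hj).2 j.2,
    fun H j hj => H ⟨j.1, by simpa using hj⟩⟩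

theorem embed_signedPerm_apply (g : (Config n (Δ \ Λ) → ℤˣ) × Equiv.Perm (Config n (Δ \ Λ)))
    (σ τ : Config n Δ) :
    embed n (Finset.sdiff_subset : Δ \ Λ ≤ Δ) (signedPerm g) σ τ =
      if τ = (configEquiv n h).symm ((configEquiv n h σ).1, g.2 (configEquiv n h σ).2) then
        ((g.1 (configEquiv n h σ).2 : ℤ) : ℂ) else 0 := by
  rw [embed_sdiff_apply_configEquiv n h, signedPerm, Matrix.of_apply, ← ite_and]
  refine if_congr ?_ rfl rfl
  rw [Equiv.eq_symm_apply, Prod.ext_iff, eq_comm (a := (configEquiv n h σ).1)]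

/-- Each row of a signed permutation matrix has a single nonzero entry, so conjugation only relabels
entries, up to two signs; the `Λ`-part of a configuration is untouched. -/
theorem conj_signedPerm_apply (g : (Config n (Δ \ Λ) → ℤˣ) × Equiv.Perm (Config n (Δ \ Λ)))
    (X : RegionAlg n Δ) (σ τ : Config n Δ) :
    (embed n (Finset.sdiff_subset : Δ \ Λ ≤ Δ) (signedPerm g) * X *
      star (embed n (Finset.sdiff_subset : Δ \ Λ ≤ Δ) (signedPerm g))) σ τ =
    ((g.1 (configEquiv n h σ).2 : ℤ) : ℂ) * ((g.1 (configEquiv n h τ).2 : ℤ) : ℂ) *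
      X ((configEquiv n h).symm ((configEquiv n h σ).1, g.2 (configEquiv n h σ).2))
        ((configEquiv n h).symm ((configEquiv n h τ).1, g.2 (configEquiv n h τ).2)) := by
  simp only [Matrix.mul_apply, Matrix.star_apply, embed_signedPerm_apply n h, ite_mul, zero_mul,
    Finset.sum_ite_eq', Finset.mem_univ, if_true, apply_ite star, star_zero, mul_ite, mul_zero,
    star_intCast]
  ring

variable [∀ j, NeZero (n j)]

theorem sum_conj_signedPerm_mem_range (X : RegionAlg n Δ) :
    ∑ g : (Config n (Δ \ Λ) → ℤˣ) × Equiv.Perm (Config n (Δ \ Λ)),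
      embed n (Finset.sdiff_subset : Δ \ Λ ≤ Δ) (signedPerm g) * X *
        star (embed n (Finset.sdiff_subset : Δ \ Λ ≤ Δ) (signedPerm g)) ∈ (embed n h).range := by
  -- Any reference configuration would do, since the sum over permutations does not depend on it.
  -- The constant sum over `_ε` in `C` supplies the multiplicity, so both sides can be compared
  -- pattern by pattern.
  let z : Config n (Δ \ Λ) := fun _ => 0
  let C : RegionAlg n Λ := Matrix.of fun a b =>
    ∑ _ε : Config n (Δ \ Λ) → ℤˣ, ∑ π : Equiv.Perm (Config n (Δ \ Λ)),
      X ((configEquiv n h).symm (a, π z)) ((configEquiv n h).symm (b, π z))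
  refine ⟨C, ?_⟩
  ext σ τ
  change embed n h C σ τ = _
  rw [embed_apply_configEquiv, Matrix.sum_apply]
  simp only [conj_signedPerm_apply n h]
  rw [Fintype.sum_prod_type]
  split_ifs with hστ
  · simp only [C, Matrix.of_apply, ← hστ]
    refine Finset.sum_congr rfl fun ε _ => ?_
    rw [sum_perm_apply_eq (fun w => X ((configEquiv n h).symm ((configEquiv n h σ).1, w))
      ((configEquiv n h).symm ((configEquiv n h τ).1, w))) z (configEquiv n h σ).2]
    refine Finset.sum_congr rfl fun π _ => ?_
    have : ((ε (configEquiv n h σ).2 : ℤ) : ℂ) * ((ε (configEquiv n h σ).2 : ℤ) : ℂ) = 1 := by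
      exact_mod_cast Int.units_coe_mul_self (ε (configEquiv n h σ).2)
    rw [this, one_mul]
  · simp only [← Finset.mul_sum]
    rw [← Finset.sum_mul, sum_sign_mul_sign hστ, zero_mul]

end Average

/-- Each conjugate of `X'` is within `ε + δ` of `X`, because `X - U X' U* = ([X, U] + U (X - X'))
U*`; an average of such elements is no farther away. -/
theorem norm_sub_average_le {𝔄 : Type*} [CStarAlgebra 𝔄] {G : Type*} [Fintype G] [Nonempty G]
    {U : G → 𝔄} (hU : ∀ g, U g ∈ unitary 𝔄) {X X' : 𝔄} {ε δ : ℝ}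
    (hX : ∀ g, ‖X * U g - U g * X‖ ≤ ε) (hX' : ‖X - X'‖ ≤ δ) :
    ‖X - (Fintype.card G : ℂ)⁻¹ • ∑ g, U g * X' * star (U g)‖ ≤ ε + δ := by
  have hG : (Fintype.card G : ℂ) ≠ 0 := by exact_mod_cast Fintype.card_ne_zero
  have hG' : (Fintype.card G : ℝ) ≠ 0 := by exact_mod_cast Fintype.card_ne_zero
  have hterm : ∀ g, ‖X - U g * X' * star (U g)‖ ≤ ε + δ := by
    intro g
    have h1 : X - U g * X' * star (U g) =
        ((X * U g - U g * X) + U g * (X - X')) * star (U g) := by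
      have := Unitary.mul_star_self_of_mem (hU g)
      simp only [mul_sub, sub_mul, add_mul, mul_assoc, this, mul_one]
      abel
    rw [h1, CStarRing.norm_mul_mem_unitary _ (Unitary.star_mem (hU g))]
    refine (norm_add_le _ _).trans (add_le_add (hX g) ?_)
    rwa [CStarRing.norm_mem_unitary_mul _ (hU g)]
  have h2 : X - (Fintype.card G : ℂ)⁻¹ • ∑ g, U g * X' * star (U g) =
      (Fintype.card G : ℂ)⁻¹ • ∑ g, (X - U g * X' * star (U g)) := by
    rw [Finset.sum_sub_distrib, smul_sub, Finset.sum_const, Finset.card_univ,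
      ← Nat.cast_smul_eq_nsmul ℂ, inv_smul_smul₀ hG]
  rw [h2, norm_smul, norm_inv, Complex.norm_natCast]
  refine (mul_le_mul_of_nonneg_left (norm_sum_le_of_le _ fun g _ => hterm g)
    (by positivity)).trans (le_of_eq ?_)
  rw [Finset.sum_const, Finset.card_univ, nsmul_eq_mul, inv_mul_cancel_left₀ hG']

/-! ### From small commutators to local approximation -/

variable {n : Lattice d → ℕ} [∀ j, NeZero (n j)]

theorem QuasiLocal.of_embed {Λ Δ : Finset (Lattice d)} (h : Λ ≤ Δ) (A : RegionAlg n Λ) :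
    QuasiLocal.of n Δ (embed n h A) = QuasiLocal.of n Λ A :=
  congrArg (QuasiLocal.coe n) (LocalObs.of_embed n h A)

theorem QuasiLocal.norm_of (Λ : Finset (Lattice d)) (A : RegionAlg n Λ) :
    ‖QuasiLocal.of n Λ A‖ = ‖A‖ :=
  (QuasiLocal.norm_coe n _).trans (LocalObs.norm_of n Λ A)

theorem QuasiLocal.exists_norm_sub_of_lt (Λ : Finset (Lattice d)) (X : QuasiLocal n) {δ : ℝ}
    (hδ : 0 < δ) : ∃ Δ, Λ ≤ Δ ∧ ∃ X' : RegionAlg n Δ, ‖X - QuasiLocal.of n Δ X'‖ < δ := by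
  obtain ⟨x, hx⟩ := (QuasiLocal.denseRange_coe n).exists_dist_lt X hδ
  obtain ⟨Γ, A, rfl⟩ := LocalObs.exists_of n x
  refine ⟨Λ ∪ Γ, Finset.subset_union_left,
    embed n (Finset.subset_union_right : Γ ≤ Λ ∪ Γ) A, ?_⟩
  rw [QuasiLocal.of_embed, ← dist_eq_norm]
  exact hx

/-- The distance to the finite-dimensional algebra `𝔸(Λ)` is attained. -/
theorem exists_forall_norm_sub_le (Λ : Finset (Lattice d)) (X : QuasiLocal n) :
    ∃ Y ∈ localAlg n Λ, ∀ Z ∈ localAlg n Λ, ‖X - Y‖ ≤ ‖X - Z‖ := by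
  have : ProperSpace (RegionAlg n Λ) := FiniteDimensional.proper ℂ _
  have hiso : Isometry (QuasiLocal.of n Λ) :=
    AddMonoidHomClass.isometry_of_norm _ (QuasiLocal.norm_of Λ)
  have htend : Filter.Tendsto (fun A : RegionAlg n Λ => ‖X - QuasiLocal.of n Λ A‖)
      (Filter.cocompact _) Filter.atTop := by
    refine Filter.tendsto_atTop_mono (f := fun A : RegionAlg n Λ => ‖A‖ - ‖X‖) (fun A => ?_)
      (Filter.tendsto_atTop_add_const_right _ _ tendsto_norm_cocompact_atTop)
    rw [← QuasiLocal.norm_of Λ A, norm_sub_rev]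
    exact norm_sub_norm_le _ _
  obtain ⟨A, hA⟩ := (continuous_const.sub hiso.continuous).norm.exists_forall_le htend
  refine ⟨_, ⟨A, rfl⟩, ?_⟩
  rintro _ ⟨B, rfl⟩
  exact hA B

/-- An observable that almost commutes with the unitaries supported away from `Λ` is close to an
observable supported in `Λ`. -/
theorem exists_mem_localAlg_of_commutator_le {Λ : Finset (Lattice d)} {X : QuasiLocal n} {ε : ℝ}
    (hX : ∀ T, Disjoint T Λ → ∀ U ∈ localAlg n T, U ∈ unitary (QuasiLocal n) →
      ‖X * U - U * X‖ ≤ ε) :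
    ∃ Y ∈ localAlg n Λ, ‖X - Y‖ ≤ ε := by
  obtain ⟨Y, hY, hmin⟩ := exists_forall_norm_sub_le Λ X
  -- The minimiser `Y` does not depend on `δ`, whereas the averaged element does; comparing with `Y`
  -- lets `δ` tend to zero without loss.
  refine ⟨Y, hY, le_of_forall_pos_le_add fun δ hδ => ?_⟩
  obtain ⟨Δ, hΔ, X', hX'⟩ := QuasiLocal.exists_norm_sub_of_lt Λ X hδ
  let U : (Config n (Δ \ Λ) → ℤˣ) × Equiv.Perm (Config n (Δ \ Λ)) → QuasiLocal n :=
    fun g => QuasiLocal.of n (Δ \ Λ) (signedPerm g)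
  have hU : ∀ g, U g ∈ unitary (QuasiLocal n) := fun g =>
    Unitary.map_mem (QuasiLocal.of n (Δ \ Λ)) (signedPerm_mem_unitary g)
  refine le_trans (hmin _ ?_) (norm_sub_average_le hU
    (fun g => hX _ Finset.sdiff_disjoint _ ⟨_, rfl⟩ (hU g)) hX'.le)
  refine (localAlg n Λ).smul_mem ?_ _
  obtain ⟨C, hC⟩ := sum_conj_signedPerm_mem_range n hΔ X'
  refine ⟨C, ?_⟩
  have := congrArg (QuasiLocal.of n Δ) hC
  change QuasiLocal.of n Δ (embed n hΔ C) = _ at this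
  rw [QuasiLocal.of_embed, map_sum] at this
  refine this.trans (Finset.sum_congr rfl fun g _ => ?_)
  rw [map_mul, map_mul, map_star, QuasiLocal.of_embed]

/-! ## Decay of the tail function -/

/-- Raising `t` by one amounts to shifting `k`, which drops the terms with `k = 0`; monotonicity of
`F` plays no role. -/
theorem gF_antitone (d : ℕ) (F : ℝ≥0 → ℝ≥0) : Antitone (gF d F) := by
  refine antitone_nat_of_succ_le fun t => ?_
  have h := ENNReal.tsum_comp_le_tsum_of_injective (f := fun k : ℕ => k + 1)
    (add_left_injective 1) fun k => ∑' l : ℕ,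
      ((t + k + l + 1 : ℕ) : ℝ≥0∞) ^ (d - 1) * F ((t + k + l : ℕ) : ℝ≥0)
  refine le_trans (le_of_eq ?_) h
  unfold gF
  refine tsum_congr fun k => tsum_congr fun l => ?_
  rw [show t + 1 + k + l = t + (k + 1) + l by ring]

theorem RapidDecay.exists_le {f : ℕ → ℝ} (hf : RapidDecay f) (k : ℕ) :
    ∃ C, 0 ≤ C ∧ ∀ r : ℕ, (1 + (r : ℝ)) ^ k * |f r| ≤ C := by
  obtain ⟨C, hC⟩ := hf k
  have h : ∀ r : ℕ, (1 + (r : ℝ)) ^ k * |f r| ≤ C := fun r => hC ⟨r, rfl⟩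
  exact ⟨C, le_trans (by positivity) (h 0), h⟩

theorem exists_pow_mul_gF_le {F : ℝ≥0 → ℝ≥0}
    (hF : RapidDecay fun r : ℕ => (F (r : ℝ≥0) : ℝ)) (m : ℕ) :
    ∃ C : ℝ≥0∞, C < ∞ ∧ ∀ t : ℕ, ((t + 1 : ℕ) : ℝ≥0∞) ^ m * gF d F t ≤ C := by
  -- With `u = t+k+l+1`, the powers `m` and `d-1` absorb the weights, and `u⁴ ≥ (k+1)²(l+1)²` makes
  -- the double series converge.
  obtain ⟨C, hC0, hC⟩ := hF.exists_le (m + (d - 1) + 4)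
  let q : ℕ → ℝ≥0∞ := fun k => ENNReal.ofReal (1 / ((k + 1 : ℕ) : ℝ) ^ 2)
  have hq : ∑' k, q k < ∞ :=
    ((summable_nat_add_iff 1).2 (Real.summable_one_div_nat_pow.2 one_lt_two)).tsum_ofReal_lt_top
  have hterm : ∀ t k l : ℕ, ((t + 1 : ℕ) : ℝ≥0∞) ^ m *
      (((t + k + l + 1 : ℕ) : ℝ≥0∞) ^ (d - 1) * F ((t + k + l : ℕ) : ℝ≥0)) ≤
      ENNReal.ofReal C * (q k * q l) := by
    intro t k l
    have hreal : ((t + 1 : ℕ) : ℝ) ^ m * (((t + k + l + 1 : ℕ) : ℝ) ^ (d - 1) *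
        F ((t + k + l : ℕ) : ℝ≥0)) ≤
        C * (1 / ((k + 1 : ℕ) : ℝ) ^ 2 * (1 / ((l + 1 : ℕ) : ℝ) ^ 2)) := by
      have h1 := hC (t + k + l)
      rw [NNReal.abs_eq, pow_add, pow_add] at h1
      rw [one_div_mul_one_div, mul_one_div, le_div_iff₀ (by positivity)]
      refine le_trans ?_ h1
      have ht : ((t + 1 : ℕ) : ℝ) ≤ 1 + ((t + k + l : ℕ) : ℝ) := by push_cast; linarith
      have hk : ((k + 1 : ℕ) : ℝ) ≤ 1 + ((t + k + l : ℕ) : ℝ) := by push_cast; linarith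
      have hl : ((l + 1 : ℕ) : ℝ) ≤ 1 + ((t + k + l : ℕ) : ℝ) := by push_cast; linarith
      have hu : ((t + k + l + 1 : ℕ) : ℝ) = 1 + ((t + k + l : ℕ) : ℝ) := by push_cast; ring
      rw [hu]
      set u : ℝ := 1 + ((t + k + l : ℕ) : ℝ)
      calc _ = ((t + 1 : ℕ) : ℝ) ^ m * u ^ (d - 1) * (((k + 1 : ℕ) : ℝ) ^ 2 *
            ((l + 1 : ℕ) : ℝ) ^ 2) * F ((t + k + l : ℕ) : ℝ≥0) := by ring
        _ ≤ u ^ m * u ^ (d - 1) * (u ^ 2 * u ^ 2) * F ((t + k + l : ℕ) : ℝ≥0) := by gcongr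
        _ = _ := by ring
    have := ENNReal.ofReal_le_ofReal hreal
    rw [ENNReal.ofReal_mul (by positivity), ENNReal.ofReal_mul (by positivity),
      ENNReal.ofReal_mul hC0, ENNReal.ofReal_mul (by positivity),
      ENNReal.ofReal_pow (by positivity), ENNReal.ofReal_pow (by positivity),
      ENNReal.ofReal_natCast, ENNReal.ofReal_natCast, ENNReal.ofReal_coe_nnreal] at this
    exact this
  refine ⟨ENNReal.ofReal C * ((∑' k, q k) * ∑' l, q l),
    ENNReal.mul_lt_top ENNReal.ofReal_lt_top (ENNReal.mul_lt_top hq hq), fun t => ?_⟩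
  unfold gF
  simp only [← ENNReal.tsum_mul_left, ← ENNReal.tsum_mul_right]
  rw [ENNReal.tsum_comm]
  refine ENNReal.tsum_le_tsum fun l => ENNReal.tsum_le_tsum fun k => ?_
  exact hterm t k l

theorem gF_lt_top {F : ℝ≥0 → ℝ≥0} (hF : RapidDecay fun r : ℕ => (F (r : ℝ≥0) : ℝ)) (t : ℕ) :
    gF d F t < ∞ := by
  obtain ⟨C, hC, h⟩ := exists_pow_mul_gF_le (d := d) hF 0
  exact lt_of_le_of_lt (by simpa using h t) hC

theorem fF_nonneg (F : ℝ≥0 → ℝ≥0) (r : ℕ) : 0 ≤ fF d F r :=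
  mul_nonneg (sq_nonneg _) ENNReal.toReal_nonneg

theorem isTail_fF {F : ℝ≥0 → ℝ≥0} (hF : RapidDecay fun r : ℕ => (F (r : ℝ≥0) : ℝ)) :
    IsTail (fF d F) := by
  refine ⟨fF_nonneg F, fun r s hrs => ?_, fun m => ?_⟩
  · exact mul_le_mul_of_nonneg_left
      (ENNReal.toReal_mono (gF_lt_top hF r).ne (gF_antitone d F hrs)) (sq_nonneg _)
  · obtain ⟨C, hC, h⟩ := exists_pow_mul_gF_le (d := d) hF m
    refine ⟨shellConst d ^ 2 * C.toReal, ?_⟩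
    rintro _ ⟨r, rfl⟩
    have h1 := ENNReal.toReal_mono hC.ne (h r)
    rw [ENNReal.toReal_mul, ENNReal.toReal_pow, ENNReal.toReal_natCast] at h1
    push_cast at h1
    change (1 + (r : ℝ)) ^ m * |fF d F r| ≤ _
    rw [abs_of_nonneg (fF_nonneg F r), fF, mul_left_comm, add_comm]
    gcongr

/-! ## Locality of automorphisms -/

variable {α : QuasiLocal n ≃⋆ₐ[ℂ] QuasiLocal n}

theorem nearContained_of_liebRobinsonBound (hd : 1 ≤ d) {F : ℝ≥0 → ℝ≥0} (hF : Antitone F)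
    (hLR : LiebRobinsonBound F α) {r : ℕ} (hg : gF d F r < ∞) (p : Lattice d) (s : ℕ) :
    NearContained ((s : ℝ) ^ (d - 1) * fF d F r)
      ((localAlg n (ball p s)).map (α : QuasiLocal n →⋆ₐ[ℂ] QuasiLocal n))
      (localAlg n (ball p (s + r))) := by
  rintro _ ⟨A, hA, rfl⟩
  change ∃ B ∈ _, ‖α A - B‖ ≤ _ * ‖α A‖
  rw [StarAlgEquiv.norm_map]
  refine exists_mem_localAlg_of_commutator_le fun T hT U hU hU' => ?_
  have hnorm : ‖U‖ ≤ 1 := by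
    rcases subsingleton_or_nontrivial (QuasiLocal n) with _ | _
    · simp [Subsingleton.elim U 0]
    · exact (CStarRing.norm_of_mem_unitary hU').le
  refine (hLR _ _ A hA U hU).trans ?_
  have h := sum_ball_sum_outside_le hd hF hg p s hT
  rw [mul_comm _ ‖A‖, mul_assoc]
  refine mul_le_mul_of_nonneg_left (le_trans ?_ h) (norm_nonneg A)
  exact mul_le_of_le_one_left
    (Finset.sum_nonneg fun _ _ => Finset.sum_nonneg fun _ _ => NNReal.coe_nonneg _) hnorm

theorem HasTails.exists_mem_norm_sub_le {f : ℕ → ℝ} (hα : HasTails α f) {p : Lattice d} {s : ℕ}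
    (r : ℕ) (hs : 1 ≤ s) {A : QuasiLocal n} (hA : A ∈ localAlg n (ball p s)) :
    ∃ B ∈ localAlg n (ball p (s + r)), ‖α A - B‖ ≤ (s : ℝ) ^ (d - 1) * f r * ‖A‖ := by
  obtain ⟨B, hB, h⟩ := hα.2 p s r hs (α A) ⟨A, hA, rfl⟩
  exact ⟨B, hB, by rwa [StarAlgEquiv.norm_map] at h⟩

theorem HasTails.isALP {f : ℕ → ℝ} (hα : HasTails α f) : IsALP α := by
  have hf := hα.1
  -- The extra `1` at `r = 0` accommodates the convention `H_α(s,0) = 1`.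
  refine ⟨fun r => f r + if r = 0 then 1 else 0, ⟨fun r => ?_, fun r s hrs => ?_, fun k => ?_⟩,
    fun s r hs => ?_⟩
  · have := hf.1 r
    positivity
  · refine add_le_add (hf.2.1 hrs) ?_
    split_ifs <;> first | omega | norm_num
  · obtain ⟨C, -, hC⟩ := hf.2.2.exists_le k
    refine ⟨C + 1, ?_⟩
    rintro _ ⟨r, rfl⟩
    refine (mul_le_mul_of_nonneg_left (abs_add_le _ _) (by positivity)).trans ?_
    rw [mul_add]
    refine add_le_add (hC r) ?_
    split_ifs with h <;> simp [h]
  · rw [spread]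
    split_ifs with hr
    · rw [ENNReal.one_le_ofReal]
      have h1 : (1 : ℝ) ≤ (s : ℝ) ^ (d - 1) := one_le_pow₀ (by exact_mod_cast hs)
      simp only [hr, if_true]
      nlinarith [hf.1 0]
    · refine iSup_le fun p => iSup_le fun A => iSup_le fun hA => iSup_le fun hA1 => ?_
      obtain ⟨B, hB, h⟩ := hα.exists_mem_norm_sub_le r hs hA
      refine (Metric.infEDist_le_edist_of_mem hB).trans ?_
      rw [edist_dist, dist_eq_norm]
      exact ENNReal.ofReal_le_ofReal (by simpa [hA1, hr] using h)

/-! ## Fréchet continuity -/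

theorem locErr_le {A B : QuasiLocal n} {r : ℕ} (hB : B ∈ localAlg n (ball 0 r)) :
    locErr A r ≤ ‖A - B‖ :=
  (Metric.infDist_le_dist_of_mem hB).trans_eq (dist_eq_norm A B)

theorem locErr_nonneg (A : QuasiLocal n) (r : ℕ) : 0 ≤ locErr A r := Metric.infDist_nonneg

theorem locErr_le_norm (A : QuasiLocal n) (r : ℕ) : locErr A r ≤ ‖A‖ := by
  simpa using locErr_le (A := A) (zero_mem (localAlg n (ball 0 r)))

theorem localAlg_mono {Λ Δ : Finset (Lattice d)} (h : Λ ≤ Δ) : localAlg n Λ ≤ localAlg n Δ := by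
  rintro _ ⟨A, rfl⟩
  exact ⟨embed n h A, QuasiLocal.of_embed h A⟩

theorem exists_norm_sub_eq_locErr (A : QuasiLocal n) (r : ℕ) :
    ∃ B ∈ localAlg n (ball 0 r), ‖A - B‖ = locErr A r := by
  obtain ⟨B, hB, h⟩ := exists_forall_norm_sub_le (ball 0 r) A
  refine ⟨B, hB, le_antisymm ?_ (locErr_le hB)⟩
  refine (Metric.le_infDist ⟨B, hB⟩).2 fun Z hZ => ?_
  rw [dist_eq_norm]
  exact h Z hZ

theorem locErr_antitone (A : QuasiLocal n) : Antitone (locErr A) := fun _ _ hrs =>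
  Metric.infDist_le_infDist_of_subset (localAlg_mono (ball_mono 0 hrs)) ⟨0, zero_mem _⟩

/-- Pass through the best approximant `B` of `A` in `B_0(s)`: `α` is isometric, so the first error
is preserved, and the tail bound applies to `α B`. The factor `2` is `‖B‖ ≤ ‖A‖ + ‖A - B‖ ≤ 2‖A‖`.
-/
theorem HasTails.locErr_map_le {f : ℕ → ℝ} (hα : HasTails α f) (A : QuasiLocal n) {s : ℕ}
    (r : ℕ) (hs : 1 ≤ s) :
    locErr (α A) (s + r) ≤ locErr A s + (s : ℝ) ^ (d - 1) * f r * (2 * ‖A‖) := by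
  obtain ⟨B, hB, hAB⟩ := exists_norm_sub_eq_locErr A s
  obtain ⟨B', hB', hBB'⟩ := hα.exists_mem_norm_sub_le r hs hB
  have hnB : ‖B‖ ≤ 2 * ‖A‖ := by
    have h1 := norm_sub_norm_le B A
    rw [norm_sub_rev, hAB] at h1
    linarith [locErr_le_norm A s]
  have h0 := hα.1.1 r
  calc locErr (α A) (s + r) ≤ ‖α A - B'‖ := locErr_le hB'
    _ ≤ ‖α A - α B‖ + ‖α B - B'‖ := norm_sub_le_norm_sub_add_norm_sub _ _ _
    _ ≤ _ := by
      rw [← map_sub, StarAlgEquiv.norm_map, hAB]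
      gcongr
      exact hBB'.trans (by gcongr)

/-- Half of the radius localises `A` and half is left to the tail of `α`. The volume factor
`s^{d-1}` is paid for by the decay of `f`, so the order `k` required of `A` does not increase. -/
theorem HasTails.exists_pow_mul_locErr_map_le {f : ℕ → ℝ} (hα : HasTails α f) (k : ℕ) :
    ∃ C : ℝ, 0 ≤ C ∧ ∀ (A : QuasiLocal n) (M : ℝ), 0 ≤ M →
      (∀ r : ℕ, (1 + (r : ℝ)) ^ k * locErr A r ≤ M) →
      ∀ r : ℕ, (1 + (r : ℝ)) ^ k * locErr (α A) r ≤ C * (‖A‖ + M) := by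
  obtain ⟨D, hD0, hD⟩ := hα.1.2.2.exists_le (k + (d - 1))
  refine ⟨2 ^ k + 2 ^ (k + (d - 1)) * D * 2, by positivity, fun A M hM0 hM r => ?_⟩
  have hA := norm_nonneg A
  -- Radii below `2` cannot be split into halves with `s ≥ 1`; there `locErr (α A) r ≤ ‖A‖` is
  -- enough.
  rcases Nat.lt_or_ge r 2 with hr | hr
  · have h1 : locErr (α A) r ≤ ‖A‖ := (locErr_le_norm _ _).trans_eq (StarAlgEquiv.norm_map α A)
    have h2 : (1 + (r : ℝ)) ≤ 2 := by
      have : (r : ℝ) ≤ 1 := by exact_mod_cast Nat.le_of_lt_succ hr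
      linarith
    calc (1 + (r : ℝ)) ^ k * locErr (α A) r ≤ 2 ^ k * ‖A‖ := by
          gcongr
          exact locErr_nonneg _ _
      _ ≤ (2 ^ k + 2 ^ (k + (d - 1)) * D * 2) * (‖A‖ + M) := by
          gcongr
          · exact le_add_of_nonneg_right (by positivity)
          · exact le_add_of_nonneg_right hM0
  · obtain ⟨s, q, hs, rfl, hsq, hqs⟩ : ∃ s q : ℕ, 1 ≤ s ∧ r = s + q ∧ s ≤ q ∧ q ≤ s + 1 :=
      ⟨r / 2, r - r / 2, by omega, by omega, by omega, by omega⟩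
    have hsq' : (s : ℝ) ≤ q := by exact_mod_cast hsq
    have hqs' : (q : ℝ) ≤ s + 1 := by exact_mod_cast hqs
    have hf := hα.1.1 q
    have hfD := hD q
    rw [abs_of_nonneg hf] at hfD
    have h1 : (1 + ((s + q : ℕ) : ℝ)) ≤ 2 * (1 + s) := by push_cast; linarith
    have h2 : (1 + ((s + q : ℕ) : ℝ)) ≤ 2 * (1 + q) := by push_cast; linarith
    have h3 : (s : ℝ) ≤ 2 * (1 + q) := by linarith
    have hl := locErr_nonneg A s
    calc (1 + ((s + q : ℕ) : ℝ)) ^ k * locErr (α A) (s + q)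
        ≤ (1 + ((s + q : ℕ) : ℝ)) ^ k *
            (locErr A s + (s : ℝ) ^ (d - 1) * f q * (2 * ‖A‖)) := by
          gcongr
          exact hα.locErr_map_le A q hs
      _ ≤ (2 * (1 + s)) ^ k * locErr A s +
            (2 * (1 + q)) ^ k * ((2 * (1 + q)) ^ (d - 1) * f q * (2 * ‖A‖)) := by
          rw [mul_add]
          gcongr
      _ = 2 ^ k * ((1 + s) ^ k * locErr A s) +
            2 ^ (k + (d - 1)) * ((1 + q) ^ (k + (d - 1)) * f q) * (2 * ‖A‖) := by
          simp only [mul_pow, pow_add]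
          ring
      _ ≤ 2 ^ k * M + 2 ^ (k + (d - 1)) * D * (2 * ‖A‖) := by
          gcongr
          exact hM s
      _ ≤ _ := by
          have e1 : (0 : ℝ) ≤ 2 ^ k * ‖A‖ := by positivity
          have e2 : 0 ≤ 2 ^ (k + (d - 1)) * D * 2 * M := by positivity
          linarith

theorem bddAbove_of_mem_almostLocal {A : QuasiLocal n} (hA : A ∈ almostLocal n) (k : ℕ) :
    BddAbove (Set.range fun r : ℕ => (1 + (r : ℝ)) ^ k * locErr A r) := by
  have := hA.2.2 k
  simpa only [abs_of_nonneg (locErr_nonneg A _)] using this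

theorem HasTails.frechetContinuous {f : ℕ → ℝ} (hα : HasTails α f) : FrechetContinuous α := by
  have key : ∀ k : ℕ, ∃ C : ℝ, 0 ≤ C ∧ ∀ A ∈ almostLocal n, ∀ r : ℕ,
      (1 + (r : ℝ)) ^ k * locErr (α A) r ≤ C * frechetNorm k A := by
    intro k
    obtain ⟨C, hC0, hC⟩ := hα.exists_pow_mul_locErr_map_le k
    refine ⟨C, hC0, fun A hA => hC A _ ?_ fun r => le_ciSup (bddAbove_of_mem_almostLocal hA k) r⟩
    exact Real.iSup_nonneg fun r => mul_nonneg (by positivity) (locErr_nonneg A r)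
  refine ⟨fun A hA => ⟨locErr_nonneg _, locErr_antitone _, fun k => ?_⟩, fun k => ?_⟩
  · obtain ⟨C, -, hC⟩ := key k
    refine ⟨C * frechetNorm k A, ?_⟩
    rintro _ ⟨r, rfl⟩
    simpa only [abs_of_nonneg (locErr_nonneg (α A) r)] using hC A hA r
  · obtain ⟨C, hC0, hC⟩ := key k
    -- The `1` covers `‖α A‖ = ‖A‖` and `C` covers the supremum, with `m = k`.
    refine ⟨k, 1 + C, by positivity, fun A hA => ?_⟩
    have h1 : ‖A‖ ≤ frechetNorm k A :=
      le_add_of_nonneg_right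
        (Real.iSup_nonneg fun r => mul_nonneg (by positivity) (locErr_nonneg A r))
    have h2 : frechetNorm k (α A) ≤ ‖A‖ + C * frechetNorm k A := by
      rw [frechetNorm, StarAlgEquiv.norm_map]
      exact add_le_add le_rfl (ciSup_le fun r => hC A hA r)
    linarith

end SpinLattice
end

theorem mainTheorem1 {d : ℕ} (hd : 1 ≤ d) (n : SpinLattice.Lattice d → ℕ) [∀ j, NeZero (n j)]
    (α : SpinLattice.QuasiLocal n ≃⋆ₐ[ℂ] SpinLattice.QuasiLocal n)
    (F : ℝ≥0 → ℝ≥0) (hF : Antitone F) (hrep : SpinLattice.IsReproducing d F)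
    (hLR : SpinLattice.LiebRobinsonBound F α) :
    ((∀ t : ℕ, SpinLattice.gF d F t < ∞) →
      ∀ (p : SpinLattice.Lattice d) (s r : ℕ), 1 ≤ s →
        SpinLattice.NearContained ((s : ℝ) ^ (d - 1) * SpinLattice.fF d F r)
          ((SpinLattice.localAlg n (SpinLattice.ball p s)).map
            (α : SpinLattice.QuasiLocal n →⋆ₐ[ℂ] SpinLattice.QuasiLocal n))
          (SpinLattice.localAlg n (SpinLattice.ball p (s + r)))) ∧
    (SpinLattice.RapidDecay (fun r : ℕ => (F (r : ℝ≥0) : ℝ)) →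
      (∀ t : ℕ, SpinLattice.gF d F t < ∞) ∧
      SpinLattice.HasTails α (SpinLattice.fF d F) ∧
      SpinLattice.IsALP α ∧
      SpinLattice.FrechetContinuous α) := by
  refine ⟨fun hg p s r _ =>
    SpinLattice.nearContained_of_liebRobinsonBound hd hF hLR (hg r) p s, fun hdecay => ?_⟩
  have htails : SpinLattice.HasTails α (SpinLattice.fF d F) :=
    ⟨SpinLattice.isTail_fF hdecay, fun p s r _ =>
      SpinLattice.nearContained_of_liebRobinsonBound hd hF hLR
        (SpinLattice.gF_lt_top hdecay r) p s⟩
  exact ⟨SpinLattice.gF_lt_top hdecay, htails, htails.isALP, htails.frechetContinuous⟩
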